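/- Let $k_0>0$, $R>0$, $z_0\in\mathbb{R}^2$ and let $K\ge 0$ and $N_s,N_r\ge 1$ be integers. Put $\theta_s=2\pi s/N_s$ ($s=1,\dots,N_s$), $\xi_s=(\cos\theta_s,\sin\theta_s)$, $\theta'_r=2\pi r/N_r$ ($r=1,\dots,N_r$), and for $m,n\in\{-K,\dots,K\}$ let $$A_{sm}=e^{ik_0\xi_s\cdot z_0}\,e^{im(\frac{\pi}{2}-\theta_s)},\qquad B_{rn}=\frac{i}{4}\,\overline{H_n^{(1)}(k_0R)}\,e^{-in\theta'_r},$$ where $H_n^{(1)}=J_n+iY_n$ is the Hankel function of the first kind of order $n$. Let $A=(A_{sm})$, $B=(B_{rn})$, and let $L:\mathbb{C}^{(2K+1)\times(2K+1)}\to\mathbb{C}^{N_s\times N_r}$ be the linear operator $$L(X)=A\,X\,B^H,$$ both matrix spaces carrying the Frobenius inner product. Let $\mathrm{cond}(L)\in[1,\infty]$ be the ratio of the largest to the smallest singular value of $L$ (equal to $\infty$ if the smallest one is $0$), and let $C_R=\dfrac{2}{e\,k_0R}$. Suppose $N_s,N_r\ge 2K+1$. Then $$\mathrm{cond}(L)\lesssim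 (C_RK)^K\qquad\text{as }K\to+\infty,$$ that is: for every $t>0$ there are a constant $C>0$ and an integer $K_0$, depending only on $t$, such that for all $K\ge K_0$, all $k_0,R>0$ with $k_0R=t$, all $z_0\in\mathbb{R}^2$ and all $N_s,N_r\ge 2K+1$, $$\mathrm{cond}(L)\le C\,(C_RK)^K .$$ In particular $L$ is injective for such $K$. -/

import Mathlib

open Filter
open scoped Matrix Nat ComplexConjugate ENNReal

noncomputable section

namespace CircularAcquisition

/-- Bessel function of the first kind `J_n(x)` of order `n ∈ ℕ`, by its power series. -/
def besselJNat (n : ℕ) (x : ℝ) : ℝ :=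
  ∑' j : ℕ, (-1) ^ j / ((j ! : ℝ) * ((n + j)! : ℝ)) * (x / 2) ^ (2 * j + n)

/-- Bessel function of the second kind (Weber's function) `Y_n(x)` of order `n ∈ ℕ` at `x > 0`,
by its classical series expansion; `harmonic j = 1 + 1/2 + ⋯ + 1/j`. -/
def besselYNat (n : ℕ) (x : ℝ) : ℝ :=
  2 / Real.pi * (Real.log (x / 2) + Real.eulerMascheroniConstant) * besselJNat n x
    - 1 / Real.pi * ∑ j ∈ Finset.range n,
        ((n - 1 - j)! : ℝ) / (j ! : ℝ) * (x / 2) ^ (2 * (j : ℤ) - (n : ℤ))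
    - 1 / Real.pi * ∑' j : ℕ,
        (-1) ^ j * ((harmonic j : ℝ) + (harmonic (n + j) : ℝ)) / ((j ! : ℝ) * ((n + j)! : ℝ))
          * (x / 2) ^ (2 * j + n)

/-- `J_n` for an integer order, with `J_{-n} = (-1)^n J_n`. -/
def besselJ (n : ℤ) (x : ℝ) : ℝ :=
  (if 0 ≤ n then 1 else (-1) ^ n.natAbs) * besselJNat n.natAbs x

/-- `Y_n` for an integer order, with `Y_{-n} = (-1)^n Y_n`. -/
def besselY (n : ℤ) (x : ℝ) : ℝ :=
  (if 0 ≤ n then 1 else (-1) ^ n.natAbs) * besselYNat n.natAbs x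

/-- Hankel function of the first kind `H_n^{(1)} = J_n + i Y_n`. -/
def hankel1 (n : ℤ) (x : ℝ) : ℂ :=
  (besselJ n x : ℂ) + Complex.I * (besselY n x : ℂ)

/-- The orders `-K, …, K`. -/
abbrev Order (K : ℕ) : Type := {n : ℤ // n ∈ Finset.Icc (-(K : ℤ)) (K : ℤ)}

/-- The equally distributed angle `2π s / N`, for `s = 1, …, N`
(the index `s : Fin N` stands for the number `s + 1`). -/
def angle (N : ℕ) (s : Fin N) : ℝ := 2 * Real.pi * ((s : ℝ) + 1) / (N : ℝ)

/-- The unit vector of angle `θ`. -/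
def direction (θ : ℝ) : EuclideanSpace ℝ (Fin 2) := !₂[Real.cos θ, Real.sin θ]

/-- Source matrix `A_{sm} = e^{i k₀ ξ_s·z₀} e^{i m (π/2 - θ_s)}`, of size `N_s × (2K+1)`. -/
def sourceMatrix (k₀ : ℝ) (z₀ : EuclideanSpace ℝ (Fin 2)) (Ns K : ℕ) :
    Matrix (Fin Ns) (Order K) ℂ :=
  Matrix.of fun s m =>
    Complex.exp (Complex.I * ((k₀ * inner ℝ (direction (angle Ns s)) z₀ : ℝ) : ℂ)) *
      Complex.exp (Complex.I * (((m : ℤ) : ℝ) * (Real.pi / 2 - angle Ns s) : ℝ))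

/-- Receiver matrix `B_{rn} = (i/4) conj(H_n^{(1)}(k₀ R)) e^{-i n θ_r}`, of size
`N_r × (2K+1)`. -/
def receiverMatrix (k₀ R : ℝ) (Nr K : ℕ) : Matrix (Fin Nr) (Order K) ℂ :=
  Matrix.of fun r n =>
    Complex.I / 4 * conj (hankel1 (n : ℤ) (k₀ * R)) *
      Complex.exp (-(Complex.I * (((n : ℤ) : ℝ) * angle Nr r : ℝ)))

/-- Matrices with complex entries, as a Hilbert space for the Frobenius inner product
`⟨X, Y⟩ = ∑ conj(X_{mn}) Y_{mn}`. -/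
abbrev FrobeniusSpace (m n : Type) : Type := EuclideanSpace ℂ (m × n)

/-- The element of `FrobeniusSpace m n` with the given matrix of entries. -/
def ofMatrix {m n : Type} (X : Matrix m n ℂ) : FrobeniusSpace m n :=
  WithLp.toLp 2 fun p => X p.1 p.2

/-- The matrix of entries of an element of `FrobeniusSpace m n`. -/
def toMatrix {m n : Type} (X : FrobeniusSpace m n) : Matrix m n ℂ :=
  Matrix.of fun i j => X (i, j)

/-- The linear operator `L(X) = A X B^H`. -/
def opL (k₀ R : ℝ) (z₀ : EuclideanSpace ℝ (Fin 2)) (Ns Nr K : ℕ) :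
    FrobeniusSpace (Order K) (Order K) →ₗ[ℂ] FrobeniusSpace (Fin Ns) (Fin Nr) where
  toFun X := ofMatrix (sourceMatrix k₀ z₀ Ns K * toMatrix X * (receiverMatrix k₀ R Nr K)ᴴ)
  map_add' X Y := by
    have h : toMatrix (X + Y) = toMatrix X + toMatrix Y := by
      ext i j; simp [toMatrix]
    rw [h, Matrix.mul_add, Matrix.add_mul]
    ext p; simp [ofMatrix]
  map_smul' c X := by
    have h : toMatrix (c • X) = c • toMatrix X := by
      ext i j; simp [toMatrix]
    rw [h, Matrix.mul_smul, Matrix.smul_mul]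
    ext p; simp [ofMatrix]

/-- Condition number of a linear map between finite-dimensional Hilbert spaces: the quotient
`σ_max / σ_min` of the largest and the smallest of its `dim E` singular values (which
`LinearMap.singularValues` lists in decreasing order), and `∞` if `σ_min = 0`, that is, if the
map is not injective. -/
def cond {E F : Type*} [NormedAddCommGroup E] [InnerProductSpace ℂ E] [FiniteDimensional ℂ E]
    [NormedAddCommGroup F] [InnerProductSpace ℂ F] [FiniteDimensional ℂ F]
    (T : E →ₗ[ℂ] F) : ℝ≥0∞ :=
  open Classical in
  if T.singularValues (Module.finrank ℂ E - 1) = 0 then ⊤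
  else ENNReal.ofReal
    (T.singularValues 0 / T.singularValues (Module.finrank ℂ E - 1))

/-- The constant `C_R = 2 / (e k₀ R)`. -/
def constCR (k₀ R : ℝ) : ℝ := 2 / (Real.exp 1 * k₀ * R)

end CircularAcquisition

end

open scoped Topology

noncomputable section

namespace CircularAcquisition

/-! Since `2K + 1 ≤ N_s, N_r`, discrete Fourier orthogonality makes the columns of `A` and of `B`
orthogonal: `AᴴA = N_s I` and `BᴴB` is diagonal with entries `(N_r/16)|H_n|²`. Hence `‖L X‖² = ∑ N_s
(N_r/16) |H_n|² |X_mn|²` (`norm_sq_opL`), and `cond L` is at most an upper bound for `|H_n(t)|`,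
`|n| ≤ K`, divided by a lower one.

The lower bound is independent of `K` (`exists_le_norm_hankel1`): `|Y_n(t)| ≥ 1` for large `n`, and
no `H_n(t)` vanishes. For the latter, `J` and `Y` satisfy the same three-term recurrence, so a
common zero would make them proportional from that order on; this is impossible as `J_n → 0`, `|Y_n|
≥ 1` and `J_n > 0` eventually.

The upper bound (`exists_norm_hankel1_le`) comes from the singular part of `Y_n`, of size
`(n-1)!/(t/2)^n`, and a Stirling estimate. -/

/-! ### Exponential majorants for the Bessel series -/

theorem abs_div_factorial_mul_pow_le {u c D : ℝ} (hu : 0 ≤ u) (n j : ℕ)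
    (hc : |c| ≤ D * (n + j)!) :
    |c / ((j ! : ℝ) * ((n + j)! : ℝ)) * u ^ (2 * j + n)| ≤ D * u ^ n * ((u ^ 2) ^ j / j !) := by
  have h1 : (0 : ℝ) < (n + j)! := by positivity
  have h2 : (0 : ℝ) < j ! := by positivity
  rw [abs_mul, abs_div, abs_of_pos (mul_pos h2 h1), abs_of_nonneg (pow_nonneg hu _),
    div_mul_eq_mul_div, div_le_iff₀ (mul_pos h2 h1)]
  calc |c| * u ^ (2 * j + n) ≤ D * (n + j)! * u ^ (2 * j + n) := by gcongr
    _ = _ := by rw [pow_add, pow_mul]; field_simp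

theorem hasSum_pow_div_factorial (y : ℝ) : HasSum (fun j : ℕ => y ^ j / j !) (Real.exp y) := by
  rw [Real.exp_eq_exp_ℝ]
  exact NormedSpace.expSeries_div_hasSum_exp (𝔸 := ℝ) y

theorem summable_of_abs_le_pow_div_factorial {f : ℕ → ℝ} {A y : ℝ}
    (h : ∀ j, |f j| ≤ A * (y ^ j / j !)) : Summable f :=
  Summable.of_norm_bounded ((hasSum_pow_div_factorial y).summable.mul_left A) h

theorem abs_tsum_le_of_abs_le_pow_div_factorial {f : ℕ → ℝ} {A y : ℝ}
    (h : ∀ j, |f j| ≤ A * (y ^ j / j !)) : |∑' j, f j| ≤ A * Real.exp y :=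
  tsum_of_norm_bounded (f := f) ((hasSum_pow_div_factorial y).mul_left A) h

/-- The `j`-th term of the power series of `J_n(2u)`. -/
def besselJTerm (n : ℕ) (u : ℝ) (j : ℕ) : ℝ :=
  (-1) ^ j / ((j ! : ℝ) * ((n + j)! : ℝ)) * u ^ (2 * j + n)

/-- The `j`-th term of the harmonic series in the expansion of `Y_n(2u)`. -/
def besselYTerm (n : ℕ) (u : ℝ) (j : ℕ) : ℝ :=
  (-1) ^ j * ((harmonic j : ℝ) + (harmonic (n + j) : ℝ)) / ((j ! : ℝ) * ((n + j)! : ℝ))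
    * u ^ (2 * j + n)

/-- The singular part of the expansion of `-π Y_n(2u)`. -/
def besselYSing (n : ℕ) (u : ℝ) : ℝ :=
  ∑ j ∈ Finset.range n, ((n - 1 - j)! : ℝ) / (j ! : ℝ) * u ^ (2 * (j : ℤ) - (n : ℤ))

theorem besselJNat_eq (n : ℕ) (x : ℝ) : besselJNat n x = ∑' j, besselJTerm n (x / 2) j := rfl

theorem besselYNat_eq (n : ℕ) (x : ℝ) : besselYNat n x =
    2 / Real.pi * (Real.log (x / 2) + Real.eulerMascheroniConstant) * besselJNat n x
    - 1 / Real.pi * besselYSing n (x / 2) - 1 / Real.pi * ∑' j, besselYTerm n (x / 2) j := rfl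

theorem harmonic_cast_nonneg (n : ℕ) : (0 : ℝ) ≤ harmonic n := by
  have : (0 : ℚ) ≤ harmonic n := Finset.sum_nonneg fun i _ => by positivity
  exact_mod_cast this

theorem harmonic_cast_succ (n : ℕ) : (harmonic (n + 1) : ℝ) = harmonic n + ((n : ℝ) + 1)⁻¹ := by
  rw [harmonic_succ]; push_cast; ring

theorem harmonic_cast_le (n : ℕ) : (harmonic n : ℝ) ≤ n := by
  induction n with
  | zero => simp
  | succ n ih =>
    rw [harmonic_cast_succ]
    have : ((n : ℝ) + 1)⁻¹ ≤ 1 := inv_le_one_of_one_le₀ (by linarith [n.cast_nonneg (α := ℝ)])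
    push_cast
    linarith

theorem abs_besselJTerm_le {u : ℝ} (hu : 0 ≤ u) (n j : ℕ) :
    |besselJTerm n u j| ≤ 1 * u ^ n * ((u ^ 2) ^ j / j !) := by
  apply abs_div_factorial_mul_pow_le hu
  have : (1 : ℝ) ≤ (n + j)! := by exact_mod_cast Nat.one_le_iff_ne_zero.mpr (Nat.factorial_ne_zero _)
  simpa using this

theorem abs_besselYTerm_le {u : ℝ} (hu : 0 ≤ u) (n j : ℕ) :
    |besselYTerm n u j| ≤ 2 * u ^ n * ((u ^ 2) ^ j / j !) := by
  apply abs_div_factorial_mul_pow_le hu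
  rw [abs_mul, abs_pow, abs_neg, abs_one, one_pow, one_mul,
    abs_of_nonneg (add_nonneg (harmonic_cast_nonneg _) (harmonic_cast_nonneg _))]
  have h1 := harmonic_cast_le j
  have h2 := harmonic_cast_le (n + j)
  have h3 : ((n + j : ℕ) : ℝ) ≤ (n + j)! := by exact_mod_cast Nat.self_le_factorial _
  have h4 : (j : ℝ) ≤ (n + j : ℕ) := by exact_mod_cast Nat.le_add_left _ _
  linarith

theorem summable_besselJTerm {u : ℝ} (hu : 0 ≤ u) (n : ℕ) : Summable (besselJTerm n u) :=
  summable_of_abs_le_pow_div_factorial (abs_besselJTerm_le hu n)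

theorem summable_besselYTerm {u : ℝ} (hu : 0 ≤ u) (n : ℕ) : Summable (besselYTerm n u) :=
  summable_of_abs_le_pow_div_factorial (abs_besselYTerm_le hu n)

/-! ### Three-term recurrences in the order -/

/-- Equal powers of `u` pair term `j` of order `n + 2` with term `j + 1` of orders `n` and `n + 1`;
`d` is the defect left at index `0`. -/
theorem tsum_recurrence {a b c : ℕ → ℝ} {r d : ℝ} (ha : Summable a) (hb : Summable b)
    (hc : Summable c) (h0 : a 0 = r * b 0 + d) (h : ∀ j, a (j + 1) + c j = r * b (j + 1)) :
    ∑' j, a j + ∑' j, c j = r * ∑' j, b j + d := by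
  rw [ha.tsum_eq_zero_add, hb.tsum_eq_zero_add, mul_add, ← tsum_mul_left,
    h0, add_assoc, ← ((summable_nat_add_iff 1).mpr ha).tsum_add hc]
  simp only [h]
  ring

theorem besselJTerm_recurrence {u : ℝ} (hu : 0 < u) (n j : ℕ) :
    besselJTerm n u (j + 1) + besselJTerm (n + 2) u j
      = (n + 1) / u * besselJTerm (n + 1) u (j + 1) := by
  have e1 : n + (j + 1) = n + j + 1 := by ring
  have e2 : n + 2 + j = n + j + 1 + 1 := by ring
  have e3 : n + 1 + (j + 1) = n + j + 1 + 1 := by ring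
  simp only [besselJTerm, e1, e2, e3, Nat.factorial_succ]
  push_cast
  field_simp
  ring

theorem besselJNat_recurrence {x : ℝ} (hx : 0 < x) (n : ℕ) :
    besselJNat n x + besselJNat (n + 2) x = (n + 1) / (x / 2) * besselJNat (n + 1) x := by
  have hu : 0 < x / 2 := by positivity
  simp only [besselJNat_eq]
  rw [← add_zero (_ * _)]
  apply tsum_recurrence (summable_besselJTerm hu.le _) (summable_besselJTerm hu.le _)
    (summable_besselJTerm hu.le _) _ (besselJTerm_recurrence hu n)
  simp only [besselJTerm, Nat.factorial_succ, add_zero, mul_zero, zero_add, pow_succ]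
  push_cast
  field_simp

theorem besselYTerm_recurrence {u : ℝ} (hu : 0 < u) (n j : ℕ) :
    besselYTerm n u (j + 1) + besselYTerm (n + 2) u j
      = (n + 1) / u * besselYTerm (n + 1) u (j + 1) := by
  have e1 : n + (j + 1) = n + j + 1 := by ring
  have e2 : n + 2 + j = n + j + 1 + 1 := by ring
  have e3 : n + 1 + (j + 1) = n + j + 1 + 1 := by ring
  simp only [besselYTerm, e1, e2, e3, Nat.factorial_succ, harmonic_cast_succ]
  push_cast
  field_simp
  ring

/-- The defect comes from `harmonic (n + 1) - harmonic n = 1 / (n + 1)` at `j = 0`; the singular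
part has the opposite one. -/
theorem tsum_besselYTerm_recurrence {u : ℝ} (hu : 0 < u) (n : ℕ) :
    ∑' j, besselYTerm n u j + ∑' j, besselYTerm (n + 2) u j
      = (n + 1) / u * ∑' j, besselYTerm (n + 1) u j + -(u ^ n / (n + 1)!) := by
  apply tsum_recurrence (summable_besselYTerm hu.le _) (summable_besselYTerm hu.le _)
    (summable_besselYTerm hu.le _) _ (besselYTerm_recurrence hu n)
  simp only [besselYTerm, Nat.factorial_succ, add_zero, mul_zero, zero_add, pow_succ,
    harmonic_cast_succ, harmonic_zero]
  push_cast
  field_simp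
  ring

/-- The three sums have `n`, `n + 2` and `n + 1` terms. After the shift by one, only the last term
of order `n + 2` has no partner; it is the defect. -/
theorem besselYSing_recurrence {u : ℝ} (hu : 0 < u) (n : ℕ) :
    besselYSing n u + besselYSing (n + 2) u
      = (n + 1) / u * besselYSing (n + 1) u + u ^ n / (n + 1)! := by
  have hterm : ∀ j ∈ Finset.range n,
      ((n - 1 - j)! : ℝ) / (j ! : ℝ) * u ^ (2 * (j : ℤ) - (n : ℤ))
        + ((n + 2 - 1 - (j + 1))! : ℝ) / ((j + 1)! : ℝ)
          * u ^ (2 * ((j + 1 : ℕ) : ℤ) - ((n + 2 : ℕ) : ℤ))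
      = (n + 1) / u * (((n + 1 - 1 - (j + 1))! : ℝ) / ((j + 1)! : ℝ)
          * u ^ (2 * ((j + 1 : ℕ) : ℤ) - ((n + 1 : ℕ) : ℤ))) := by
    intro j hj
    obtain ⟨k, rfl⟩ := Nat.exists_eq_add_of_lt (Finset.mem_range.mp hj)
    have e1 : j + k + 1 - 1 - j = k := by omega
    have e2 : j + k + 1 + 2 - 1 - (j + 1) = k + 1 := by omega
    have e3 : j + k + 1 + 1 - 1 - (j + 1) = k := by omega
    have z1 : (2 * ((j + 1 : ℕ) : ℤ) - ((j + k + 1 + 2 : ℕ) : ℤ)) = 2 * j - (j + k + 1 : ℕ) := by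
      push_cast; ring
    have z2 : (2 * ((j + 1 : ℕ) : ℤ) - ((j + k + 1 + 1 : ℕ) : ℤ))
        = 2 * j - (j + k + 1 : ℕ) + 1 := by push_cast; ring
    rw [e1, e2, e3, z1, z2, zpow_add_one₀ hu.ne', Nat.factorial_succ, Nat.factorial_succ]
    push_cast
    field_simp
    ring
  have h0 : ((n + 2 - 1 - 0)! : ℝ) / (0 ! : ℝ) * u ^ (2 * ((0 : ℕ) : ℤ) - ((n + 2 : ℕ) : ℤ))
      = (n + 1) / u * (((n + 1 - 1 - 0)! : ℝ) / (0 ! : ℝ)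
        * u ^ (2 * ((0 : ℕ) : ℤ) - ((n + 1 : ℕ) : ℤ))) := by
    have z : (2 * ((0 : ℕ) : ℤ) - ((n + 1 : ℕ) : ℤ))
        = 2 * ((0 : ℕ) : ℤ) - ((n + 2 : ℕ) : ℤ) + 1 := by push_cast; ring
    rw [z, zpow_add_one₀ hu.ne']
    have e : n + 2 - 1 - 0 = n + 1 := by omega
    rw [e, Nat.factorial_succ]
    simp
    field_simp
  have hlast : ((n + 2 - 1 - (n + 1))! : ℝ) / ((n + 1)! : ℝ)
      * u ^ (2 * ((n + 1 : ℕ) : ℤ) - ((n + 2 : ℕ) : ℤ)) = u ^ n / (n + 1)! := by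
    have z : (2 * ((n + 1 : ℕ) : ℤ) - ((n + 2 : ℕ) : ℤ)) = n := by push_cast; ring
    have e : n + 2 - 1 - (n + 1) = 0 := by omega
    rw [z, e, zpow_natCast, Nat.factorial_zero]
    push_cast
    ring
  rw [besselYSing, besselYSing, besselYSing, Finset.sum_range_succ _ (n + 1),
    Finset.sum_range_succ' _ n, Finset.sum_range_succ' _ n, hlast, h0, mul_add, Finset.mul_sum,
    ← Finset.sum_congr rfl hterm, Finset.sum_add_distrib]
  ring

theorem besselYNat_recurrence {x : ℝ} (hx : 0 < x) (n : ℕ) :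
    besselYNat n x + besselYNat (n + 2) x = (n + 1) / (x / 2) * besselYNat (n + 1) x := by
  have hu : 0 < x / 2 := by positivity
  have h1 := besselJNat_recurrence hx n
  have h2 := besselYSing_recurrence hu n
  have h3 := tsum_besselYTerm_recurrence hu n
  simp only [besselYNat_eq]
  linear_combination (2 / Real.pi * (Real.log (x / 2) + Real.eulerMascheroniConstant)) * h1
    - 1 / Real.pi * h2 - 1 / Real.pi * h3

/-! ### Size of `J_n` and `Y_n` for large order -/

theorem abs_besselJNat_le {x : ℝ} (hx : 0 < x) (n : ℕ) :
    |besselJNat n x| ≤ (x / 2) ^ n * Real.exp ((x / 2) ^ 2) := by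
  rw [besselJNat_eq]
  simpa using abs_tsum_le_of_abs_le_pow_div_factorial (abs_besselJTerm_le (u := x / 2) (by positivity) n)

theorem abs_tsum_besselYTerm_le {u : ℝ} (hu : 0 < u) (n : ℕ) :
    |∑' j, besselYTerm n u j| ≤ 2 * u ^ n * Real.exp (u ^ 2) :=
  abs_tsum_le_of_abs_le_pow_div_factorial (abs_besselYTerm_le hu.le n)

theorem le_besselYSing_succ {u : ℝ} (hu : 0 < u) (n : ℕ) :
    n ! / u ^ (n + 1) ≤ besselYSing (n + 1) u := by
  have h := Finset.single_le_sum (f := fun j : ℕ => ((n + 1 - 1 - j)! : ℝ) / (j ! : ℝ)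
    * u ^ (2 * (j : ℤ) - ((n + 1 : ℕ) : ℤ))) (fun j _ => by positivity)
    (Finset.mem_range.mpr n.succ_pos)
  refine le_trans (le_of_eq ?_) h
  have z : 2 * ((0 : ℕ) : ℤ) - ((n + 1 : ℕ) : ℤ) = -((n + 1 : ℕ) : ℤ) := by simp
  rw [z, zpow_neg, zpow_natCast]
  simp [div_eq_mul_inv]

/-- Bounding each `(n - j)!` by `n !` leaves a partial sum of the series of `exp (u ^ 2)`. -/
theorem besselYSing_succ_le {u : ℝ} (hu : 0 < u) (n : ℕ) :
    besselYSing (n + 1) u ≤ n ! / u ^ (n + 1) * Real.exp (u ^ 2) := by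
  have h1 : ∑ j ∈ Finset.range (n + 1), (u ^ 2) ^ j / j ! ≤ Real.exp (u ^ 2) :=
    (hasSum_pow_div_factorial (u ^ 2)).summable.sum_le_tsum _ (fun j _ => by positivity)
      |>.trans_eq (hasSum_pow_div_factorial (u ^ 2)).tsum_eq
  refine le_trans ?_ (mul_le_mul_of_nonneg_left h1 (by positivity))
  rw [besselYSing, Finset.mul_sum]
  refine Finset.sum_le_sum fun j _ => ?_
  have hf : ((n + 1 - 1 - j)! : ℝ) ≤ n ! := by
    exact_mod_cast Nat.factorial_le (by omega)
  have hz : u ^ (2 * (j : ℤ) - ((n + 1 : ℕ) : ℤ)) = (u ^ 2) ^ j / u ^ (n + 1) := by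
    rw [zpow_sub₀ hu.ne', zpow_natCast, ← pow_mul, ← zpow_natCast u (2 * j)]
    push_cast; rfl
  rw [hz]
  calc _ ≤ (n ! : ℝ) / j ! * ((u ^ 2) ^ j / u ^ (n + 1)) := by gcongr
    _ = _ := by ring

theorem pow_div_factorial_le_exp {u : ℝ} (hu : 0 ≤ u) (n : ℕ) : u ^ n / n ! ≤ Real.exp u :=
  (hasSum_pow_div_factorial u).tsum_eq ▸
    (hasSum_pow_div_factorial u).summable.le_tsum n (fun j _ => by positivity)

theorem tendsto_const_mul_pow_div_factorial (c y : ℝ) :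
    Tendsto (fun n : ℕ => c * (y ^ n / n !)) atTop (𝓝 0) := by
  simpa using (FloorSemiring.tendsto_pow_div_factorial_atTop y).const_mul c

theorem abs_besselJTerm_succ_le {u : ℝ} (hu : 0 ≤ u) (n j : ℕ) :
    |besselJTerm n u (j + 1)| ≤ u ^ (n + 2) / (n + 1)! * ((u ^ 2) ^ j / j !) := by
  have h1 : (-1 : ℝ) ^ (j + 1) / (((j + 1)! : ℝ) * ((n + (j + 1))! : ℝ)) * u ^ (2 * (j + 1) + n)
    = besselJTerm n u (j + 1) := rfl
  rw [← h1, abs_mul, abs_div, abs_pow, abs_neg, abs_one, one_pow,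
    abs_of_nonneg (pow_nonneg hu _), abs_of_pos (by positivity)]
  have h2 : (j ! : ℝ) ≤ (j + 1)! := by exact_mod_cast Nat.factorial_le (by omega)
  have h3 : ((n + 1)! : ℝ) ≤ (n + (j + 1))! := by exact_mod_cast Nat.factorial_le (by omega)
  calc _ ≤ 1 / ((j ! : ℝ) * ((n + 1)! : ℝ)) * u ^ (2 * (j + 1) + n) := by gcongr
    _ = _ := by ring

/-- The leading term `u ^ n / n !` outweighs the rest of the series once `n > u ^ 2 * exp (u ^ 2)`.
-/
theorem eventually_besselJNat_pos {x : ℝ} (hx : 0 < x) : ∀ᶠ n in atTop, 0 < besselJNat n x := by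
  have hu : 0 < x / 2 := by positivity
  set u := x / 2
  have ht : ∀ᶠ n : ℕ in atTop, u ^ 2 * Real.exp (u ^ 2) < n :=
    tendsto_natCast_atTop_atTop.eventually_gt_atTop _
  filter_upwards [ht] with n hn
  have h1 := abs_tsum_le_of_abs_le_pow_div_factorial (abs_besselJTerm_succ_le hu.le n)
  rw [besselJNat_eq, (summable_besselJTerm hu.le n).tsum_eq_zero_add]
  have h0 : besselJTerm n u 0 = u ^ n / n ! := by
    simp [besselJTerm]; ring
  have h2 : u ^ (n + 2) / (n + 1)! * Real.exp (u ^ 2) < u ^ n / n ! := by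
    rw [Nat.factorial_succ, div_mul_eq_mul_div, div_lt_div_iff₀ (by positivity) (by positivity)]
    push_cast
    calc _ = (u ^ n * n !) * (u ^ 2 * Real.exp (u ^ 2)) := by ring
      _ < (u ^ n * n !) * (n + 1) := by gcongr; linarith
      _ = _ := by ring
  rw [h0]
  linarith [neg_abs_le (∑' j, besselJTerm n u (j + 1))]

theorem abs_besselJNat_le_div_factorial {x : ℝ} (hx : 0 < x) (n : ℕ) :
    |besselJNat n x| ≤ Real.exp ((x / 2) ^ 2) * ((x / 2) ^ n / n !) := by
  have hu : 0 < x / 2 := by positivity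
  rw [besselJNat_eq, mul_comm]
  refine abs_tsum_le_of_abs_le_pow_div_factorial fun j => ?_
  rw [besselJTerm, abs_mul, abs_div, abs_pow, abs_neg, abs_one, one_pow,
    abs_of_nonneg (pow_nonneg hu.le _), abs_of_pos (by positivity)]
  have h3 : (n ! : ℝ) ≤ (n + j)! := by exact_mod_cast Nat.factorial_le (by omega)
  calc _ ≤ 1 / ((j ! : ℝ) * (n ! : ℝ)) * (x / 2) ^ (2 * j + n) := by gcongr
    _ = _ := by rw [pow_add, pow_mul]; ring

theorem tendsto_besselJNat {x : ℝ} (hx : 0 < x) :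
    Tendsto (fun n => besselJNat n x) atTop (𝓝 0) :=
  squeeze_zero_norm (abs_besselJNat_le_div_factorial hx) (tendsto_const_mul_pow_div_factorial _ _)

/-- Bound for the ratio between the regular part of `π Y_n(x)` and `(x / 2) ^ n`. -/
def besselYConst (x : ℝ) : ℝ :=
  2 * (|Real.log (x / 2) + Real.eulerMascheroniConstant| + 1) * Real.exp ((x / 2) ^ 2)

theorem abs_pi_mul_besselYNat_add_le {x : ℝ} (hx : 0 < x) (n : ℕ) :
    |Real.pi * besselYNat n x + besselYSing n (x / 2)| ≤ besselYConst x * (x / 2) ^ n := by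
  have h1 := abs_besselJNat_le hx n
  have h2 := abs_tsum_besselYTerm_le (u := x / 2) (by positivity) n
  have h3 : Real.pi * besselYNat n x + besselYSing n (x / 2)
      = 2 * ((Real.log (x / 2) + Real.eulerMascheroniConstant) * besselJNat n x)
        - ∑' j, besselYTerm n (x / 2) j := by
    rw [besselYNat_eq]
    field_simp
    ring
  rw [h3]
  calc _ ≤ 2 * (|Real.log (x / 2) + Real.eulerMascheroniConstant| * |besselJNat n x|)
        + |∑' j, besselYTerm n (x / 2) j| := by
        refine (abs_sub _ _).trans ?_
        rw [abs_mul, abs_mul, abs_two]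
    _ ≤ 2 * (|Real.log (x / 2) + Real.eulerMascheroniConstant|
          * ((x / 2) ^ n * Real.exp ((x / 2) ^ 2)))
        + 2 * (x / 2) ^ n * Real.exp ((x / 2) ^ 2) := by gcongr
    _ = _ := by rw [besselYConst]; ring

theorem besselYConst_pos (x : ℝ) : 0 < besselYConst x := by
  rw [besselYConst]; positivity

theorem eventually_one_le_abs_besselYNat {x : ℝ} (hx : 0 < x) :
    ∀ᶠ n in atTop, 1 ≤ |besselYNat n x| := by
  have hu : 0 < x / 2 := by positivity
  set u := x / 2
  -- Relative to the singular size `n ! / u ^ (n + 1)`, both the regular part and the constant `π`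
  -- are eventually at most one half.
  have h1 := (tendsto_const_mul_pow_div_factorial (besselYConst x * u ^ 2) (u ^ 2)).eventually
    (gt_mem_nhds (show (0 : ℝ) < 1 / 2 by norm_num))
  have h2 := (tendsto_const_mul_pow_div_factorial (Real.pi * u) u).eventually
    (gt_mem_nhds (show (0 : ℝ) < 1 / 2 by norm_num))
  have h3 : ∀ᶠ n in atTop, 1 ≤ |besselYNat (n + 1) x| := by
    filter_upwards [h1, h2] with n h1 h2
    have h4 := le_besselYSing_succ hu n
    have h5 := (abs_le.mp (abs_pi_mul_besselYNat_add_le hx (n + 1))).2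
    have h6 : besselYConst x * u ^ (n + 1) ≤ 1 / 2 * (n ! / u ^ (n + 1)) := by
      calc _ = besselYConst x * u ^ 2 * ((u ^ 2) ^ n / n !) * (n ! / u ^ (n + 1)) := by
            field_simp
            ring_nf
        _ ≤ _ := by gcongr
    have h7 : Real.pi ≤ 1 / 2 * (n ! / u ^ (n + 1)) := by
      calc _ = Real.pi * u * (u ^ n / n !) * (n ! / u ^ (n + 1)) := by
            field_simp
            rw [pow_succ']
        _ ≤ _ := by gcongr
    have h8 : Real.pi * 1 ≤ Real.pi * (-besselYNat (n + 1) x) := by linarith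
    exact (le_of_mul_le_mul_left h8 Real.pi_pos).trans (neg_le_abs _)
  obtain ⟨N, hN⟩ := eventually_atTop.mp h3
  refine eventually_atTop.mpr ⟨N + 1, fun n hn => ?_⟩
  obtain ⟨k, rfl⟩ := Nat.exists_eq_add_of_le' hn
  exact hN (k + N) (by omega)

/-! ### Nonvanishing and lower bound for Hankel functions -/

theorem besselJNat_besselYNat_not_both_zero {x : ℝ} (hx : 0 < x) (n : ℕ) :
    ¬ (besselJNat n x = 0 ∧ besselYNat n x = 0) := by
  rintro ⟨hJ, hY⟩
  -- Proportionality is carried for two consecutive orders, as a three-term recurrence requires.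
  have key : ∀ m, besselJNat (n + m) x * besselYNat (n + 1) x
        = besselYNat (n + m) x * besselJNat (n + 1) x ∧
      besselJNat (n + (m + 1)) x * besselYNat (n + 1) x
        = besselYNat (n + (m + 1)) x * besselJNat (n + 1) x := by
    intro m
    induction m with
    | zero => exact ⟨by simp [hJ, hY], mul_comm _ _⟩
    | succ m ih =>
      refine ⟨ih.2, ?_⟩
      have h1 := besselJNat_recurrence hx (n + m)
      have h2 := besselYNat_recurrence hx (n + m)
      have e : n + (m + 1 + 1) = n + m + 2 := by ring
      have e' : n + (m + 1) = n + m + 1 := by ring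
      rw [e'] at ih
      rw [e]
      linear_combination h1 * besselYNat (n + 1) x - h2 * besselJNat (n + 1) x - ih.1
        + (((n + m : ℕ) : ℝ) + 1) / (x / 2) * ih.2
  have key' : ∀ᶠ m in atTop, besselJNat m x * besselYNat (n + 1) x
      = besselYNat m x * besselJNat (n + 1) x :=
    eventually_atTop.mpr ⟨n, fun m hm => by
      obtain ⟨k, rfl⟩ := Nat.exists_eq_add_of_le hm
      exact (key k).1⟩
  -- For large `m`, `|J_{n+1}| ≤ |Y_m J_{n+1}| = |J_m Y_{n+1}|`, which tends to `0`.
  have hJ1 : besselJNat (n + 1) x = 0 := by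
    have hlim : Tendsto (fun m => |besselJNat m x * besselYNat (n + 1) x|) atTop (𝓝 0) := by
      simpa using ((tendsto_besselJNat hx).mul_const (besselYNat (n + 1) x)).abs
    have hle : |besselJNat (n + 1) x| ≤ 0 := by
      refine ge_of_tendsto hlim ?_
      filter_upwards [key', eventually_one_le_abs_besselYNat hx] with m h1 h2
      rw [h1, abs_mul]
      exact le_mul_of_one_le_left (abs_nonneg _) h2
    exact abs_eq_zero.mp (le_antisymm hle (abs_nonneg _))
  have hzero : ∀ m, besselJNat (n + m) x = 0 ∧ besselJNat (n + (m + 1)) x = 0 := by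
    intro m
    induction m with
    | zero => exact ⟨hJ, hJ1⟩
    | succ m ih =>
      refine ⟨ih.2, ?_⟩
      have h1 := besselJNat_recurrence hx (n + m)
      have e' : n + (m + 1) = n + m + 1 := by ring
      rw [ih.1, ← e', ih.2] at h1
      simpa [add_assoc] using h1
  obtain ⟨N, hN⟩ := eventually_atTop.mp (eventually_besselJNat_pos hx)
  exact (hN (n + N) (by omega)).ne' (hzero N).1

theorem norm_hankel1 (n : ℤ) (x : ℝ) :
    ‖hankel1 n x‖ = Real.sqrt (besselJNat n.natAbs x ^ 2 + besselYNat n.natAbs x ^ 2) := by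
  have h : hankel1 n x = (besselJ n x : ℂ) + (besselY n x : ℂ) * Complex.I := by
    rw [hankel1, mul_comm]
  rw [h, Complex.norm_add_mul_I, besselJ, besselY, mul_pow, mul_pow]
  have hs : (if 0 ≤ n then (1 : ℝ) else (-1) ^ n.natAbs) ^ 2 = 1 := by
    split_ifs
    · simp
    · rw [← pow_mul, mul_comm, pow_mul]; simp
  rw [hs, one_mul, one_mul]

theorem norm_hankel1_natAbs (n : ℤ) (x : ℝ) : ‖hankel1 n x‖ = ‖hankel1 (n.natAbs : ℤ) x‖ := by
  rw [norm_hankel1, norm_hankel1, Int.natAbs_natCast]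

theorem hankel1_ne_zero (n : ℤ) {x : ℝ} (hx : 0 < x) : hankel1 n x ≠ 0 := by
  rw [← norm_pos_iff, norm_hankel1, Real.sqrt_pos]
  by_contra! h
  refine besselJNat_besselYNat_not_both_zero hx n.natAbs ⟨?_, ?_⟩ <;>
  nlinarith [sq_nonneg (besselJNat n.natAbs x), sq_nonneg (besselYNat n.natAbs x)]

/-- For fixed argument, the Hankel functions are bounded away from zero uniformly in the order. -/
theorem exists_le_norm_hankel1 {x : ℝ} (hx : 0 < x) :
    ∃ c : ℝ, 0 < c ∧ ∀ n : ℤ, c ≤ ‖hankel1 n x‖ := by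
  obtain ⟨N, hN⟩ := eventually_atTop.mp (eventually_one_le_abs_besselYNat hx)
  -- The bound is the minimum of `1`, valid for orders at least `N`, and the finitely many remaining
  -- norms.
  have hne : (insert 1 ((Finset.range N).image fun n : ℕ => ‖hankel1 n x‖)).Nonempty := by simp
  refine ⟨_, (Finset.lt_min'_iff _ hne).mpr ?_, fun n => ?_⟩
  · intro y hy
    rcases Finset.mem_insert.mp hy with rfl | hy
    · exact one_pos
    · obtain ⟨n, _, rfl⟩ := Finset.mem_image.mp hy
      exact norm_pos_iff.mpr (hankel1_ne_zero _ hx)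
  · rw [norm_hankel1_natAbs]
    by_cases h : n.natAbs < N
    · exact Finset.min'_le _ _ (Finset.mem_insert_of_mem
        (Finset.mem_image_of_mem (fun n : ℕ => ‖hankel1 n x‖) (Finset.mem_range.mpr h)))
    · refine (Finset.min'_le _ 1 (Finset.mem_insert_self _ _)).trans ?_
      rw [norm_hankel1, Int.natAbs_natCast]
      refine (hN _ (not_lt.mp h)).trans ?_
      exact Real.abs_le_sqrt (by nlinarith [sq_nonneg (besselJNat n.natAbs x)])

/-! ### Upper bound for Hankel functions -/

theorem norm_hankel1_le (n : ℤ) (x : ℝ) :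
    ‖hankel1 n x‖ ≤ |besselJNat n.natAbs x| + |besselYNat n.natAbs x| := by
  rw [norm_hankel1, ← sq_abs, ← sq_abs (besselYNat _ _)]
  refine Real.sqrt_le_iff.mpr ⟨by positivity, ?_⟩
  nlinarith [abs_nonneg (besselJNat n.natAbs x), abs_nonneg (besselYNat n.natAbs x)]

theorem exists_norm_hankel1_succ_le {x : ℝ} (hx : 0 < x) :
    ∃ M : ℝ, 0 < M ∧ ∀ n : ℕ, ‖hankel1 (n + 1 : ℕ) x‖ ≤ M * (n ! / (x / 2) ^ (n + 1)) := by
  have hu : 0 < x / 2 := by positivity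
  have hc := besselYConst_pos x
  refine ⟨((x / 2) ^ 2 * (Real.exp ((x / 2) ^ 2) + besselYConst x) + 1) * Real.exp ((x / 2) ^ 2),
    by positivity, fun n => ?_⟩
  have h1 := abs_besselJNat_le hx (n + 1)
  have h2 := abs_pi_mul_besselYNat_add_le hx (n + 1)
  have h3 := besselYSing_succ_le hu n
  have h3' : 0 ≤ besselYSing (n + 1) (x / 2) := by
    exact le_trans (by positivity) (le_besselYSing_succ hu n)
  have h4 : |besselYNat (n + 1) x| ≤ besselYSing (n + 1) (x / 2)
      + besselYConst x * (x / 2) ^ (n + 1) := by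
    have : |Real.pi * besselYNat (n + 1) x| ≤ besselYSing (n + 1) (x / 2)
        + besselYConst x * (x / 2) ^ (n + 1) := by
      rw [abs_le] at h2 ⊢
      constructor <;> linarith
    rw [abs_mul, abs_of_pos Real.pi_pos] at this
    refine le_trans (le_mul_of_one_le_left (abs_nonneg _) ?_) this
    linarith [Real.pi_gt_three]
  have h5 := norm_hankel1_le ((n + 1 : ℕ) : ℤ) x
  rw [Int.natAbs_natCast] at h5
  have h6 : (x / 2) ^ (n + 1)
      ≤ (x / 2) ^ 2 * Real.exp ((x / 2) ^ 2) * (n ! / (x / 2) ^ (n + 1)) := by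
    calc _ = (x / 2) ^ 2 * (((x / 2) ^ 2) ^ n / n !) * (n ! / (x / 2) ^ (n + 1)) := by
          rw [← pow_mul, mul_comm 2 n, pow_mul]
          field_simp
          ring
      _ ≤ _ := by
          gcongr
          exact pow_div_factorial_le_exp (by positivity) n
  calc _ ≤ (Real.exp ((x / 2) ^ 2) + besselYConst x) * (x / 2) ^ (n + 1)
          + n ! / (x / 2) ^ (n + 1) * Real.exp ((x / 2) ^ 2) := by linarith
    _ ≤ (Real.exp ((x / 2) ^ 2) + besselYConst x)
          * ((x / 2) ^ 2 * Real.exp ((x / 2) ^ 2) * (n ! / (x / 2) ^ (n + 1)))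
          + n ! / (x / 2) ^ (n + 1) * Real.exp ((x / 2) ^ 2) := by gcongr
    _ = _ := by ring

/-- The sequence `n ! / u ^ (n + 1)` decreases while `n + 1 < u`; the factor `exp u` compensates, so
the top order controls all lower ones. -/
theorem factorial_div_pow_le {u : ℝ} (hu : 0 < u) {n m : ℕ} (h : n ≤ m) :
    n ! / u ^ (n + 1) ≤ Real.exp u * (m ! / u ^ (m + 1)) := by
  obtain ⟨k, rfl⟩ := Nat.exists_eq_add_of_le h
  have h1 : (n ! : ℝ) * k ! ≤ (n + k)! := by
    exact_mod_cast Nat.le_of_dvd (Nat.factorial_pos _) (Nat.factorial_mul_factorial_dvd_factorial_add n k)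
  calc _ = u ^ k / k ! * (n ! * k ! / u ^ (n + k + 1)) := by
        field_simp
        ring
    _ ≤ _ := by
        gcongr
        exact pow_div_factorial_le_exp hu.le k

/-- Stirling's sequence decreases from `e / √2`. Its factor `√(n + 1) ≤ n + 1` is absorbed on
passing from `(n + 1)!` to `n !`. -/
theorem factorial_le_exp_mul_pow (n : ℕ) :
    (n ! : ℝ) ≤ Real.exp 1 * (((n + 1 : ℕ) : ℝ) / Real.exp 1) ^ (n + 1) := by
  have h := Stirling.stirlingSeq'_antitone (Nat.zero_le n)
  simp only [Function.comp, Nat.succ_eq_add_one, zero_add, Stirling.stirlingSeq_one] at h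
  rw [Stirling.stirlingSeq, div_le_iff₀ (by positivity), Nat.factorial_succ,
    Real.sqrt_mul (by norm_num)] at h
  push_cast at h ⊢
  have hn : (0 : ℝ) < (n : ℝ) + 1 := by positivity
  have h2 : Real.sqrt ((n : ℝ) + 1) ≤ n + 1 := by
    rw [Real.sqrt_le_iff]
    exact ⟨hn.le, by nlinarith [n.cast_nonneg (α := ℝ)]⟩
  have h3 : ((n : ℝ) + 1) * n ! ≤ Real.exp 1 * Real.sqrt (n + 1) * (((n : ℝ) + 1) / Real.exp 1) ^ (n + 1) := by
    refine h.trans (le_of_eq ?_)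
    field_simp
  have h4 : ((n : ℝ) + 1) * n ! ≤ (n + 1) * (Real.exp 1 * (((n : ℝ) + 1) / Real.exp 1) ^ (n + 1)) := by
    refine h3.trans ?_
    calc _ ≤ Real.exp 1 * (n + 1) * (((n : ℝ) + 1) / Real.exp 1) ^ (n + 1) := by gcongr
      _ = _ := by ring
  exact le_of_mul_le_mul_left h4 hn

/-- For fixed argument, the Hankel functions of order at most `K` are `O((2K/(ex))^K)`. -/
theorem exists_norm_hankel1_le {x : ℝ} (hx : 0 < x) :
    ∃ M : ℝ, 0 < M ∧ ∀ K : ℕ, 1 ≤ K → ∀ n : ℤ, n.natAbs ≤ K →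
      ‖hankel1 n x‖ ≤ M * (2 / (Real.exp 1 * x) * K) ^ K := by
  obtain ⟨M, hM, hle⟩ := exists_norm_hankel1_succ_le hx
  have hu : 0 < x / 2 := by positivity
  have h0 : 0 ≤ ‖hankel1 0 x‖ := norm_nonneg _
  -- `M` serves orders at least `1` and the second summand order `0`; `exp (x / 2)` comes from
  -- comparing orders, `exp 1` from Stirling.
  refine ⟨(M + ‖hankel1 0 x‖ * (x / 2)) * Real.exp (x / 2) * Real.exp 1, by positivity, ?_⟩
  intro K hK n hn
  obtain ⟨k, rfl⟩ := Nat.exists_eq_add_of_le' hK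
  have hstep : ∀ m : ℕ, m ≤ k + 1 → ‖hankel1 m x‖ ≤
      (M + ‖hankel1 0 x‖ * (x / 2)) * (Real.exp (x / 2) * (k ! / (x / 2) ^ (k + 1))) := by
    intro m hm
    rw [add_mul]
    cases m with
    | zero =>
      have h := factorial_div_pow_le hu (Nat.zero_le k)
      have h1 : ‖hankel1 0 x‖ = ‖hankel1 0 x‖ * (x / 2) * ((0 ! : ℕ) / (x / 2) ^ (0 + 1)) := by
        simp
        field_simp
      have h2 := mul_le_mul_of_nonneg_left h (mul_nonneg h0 hu.le)
      rw [← h1] at h2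
      have h3 : 0 ≤ M * (Real.exp (x / 2) * (k ! / (x / 2) ^ (k + 1))) := by positivity
      simpa using h2.trans (le_add_of_nonneg_left h3)
    | succ m =>
      refine (hle m).trans (le_add_of_le_of_nonneg ?_ (by positivity))
      exact mul_le_mul_of_nonneg_left (factorial_div_pow_le hu (by omega)) hM.le
  rw [norm_hankel1_natAbs]
  refine (hstep _ hn).trans ?_
  calc _ ≤ (M + ‖hankel1 0 x‖ * (x / 2)) * (Real.exp (x / 2) *
        (Real.exp 1 * (((k + 1 : ℕ) : ℝ) / Real.exp 1) ^ (k + 1) / (x / 2) ^ (k + 1))) := by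
        gcongr
        exact factorial_le_exp_mul_pow k
    _ = (M + ‖hankel1 0 x‖ * (x / 2)) * Real.exp (x / 2) * Real.exp 1 *
        ((((k + 1 : ℕ) : ℝ) / Real.exp 1) / (x / 2)) ^ (k + 1) := by rw [div_pow _ (x / 2)]; ring
    _ = _ := by
        congr 2
        field_simp

/-! ### Singular values and two-sided norm bounds -/

theorem norm_sq_adjoint_comp_self_eigenvector {E F : Type*}
    [NormedAddCommGroup E] [InnerProductSpace ℂ E] [FiniteDimensional ℂ E]
    [NormedAddCommGroup F] [InnerProductSpace ℂ F] [FiniteDimensional ℂ F]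
    (T : E →ₗ[ℂ] F) {i : ℕ} (hi : i < Module.finrank ℂ E) :
    ∃ v : E, v ≠ 0 ∧ ‖T v‖ = T.singularValues i * ‖v‖ := by
  obtain ⟨v, hv⟩ := (T.hasEigenvalue_adjoint_comp_self_sq_singularValues hi).exists_hasEigenvector
  refine ⟨v, hv.2, ?_⟩
  have h1 : LinearMap.adjoint T (T v) = ((T.singularValues i : ℂ) ^ 2) • v := hv.apply_eq_smul
  have h2 : inner ℂ (T v) (T v) = (T.singularValues i : ℂ) ^ 2 * inner ℂ v v := by
    rw [← LinearMap.adjoint_inner_right, h1, inner_smul_right]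
  rw [inner_self_eq_norm_sq_to_K, inner_self_eq_norm_sq_to_K] at h2
  have h3 : ‖T v‖ ^ 2 = (T.singularValues i * ‖v‖) ^ 2 := by
    rw [mul_pow]
    apply Complex.ofReal_injective
    simpa using h2
  exact (sq_eq_sq₀ (norm_nonneg _) (mul_nonneg (T.singularValues_nonneg i) (norm_nonneg _))).mp h3

/-- Testing the bounds on singular vectors for the extreme singular values gives `σ_max ≤ M` and
`σ_min ≥ c > 0`, which excludes the value `⊤`. -/
theorem cond_le {E F : Type*} [Nontrivial E]
    [NormedAddCommGroup E] [InnerProductSpace ℂ E] [FiniteDimensional ℂ E]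
    [NormedAddCommGroup F] [InnerProductSpace ℂ F] [FiniteDimensional ℂ F]
    (T : E →ₗ[ℂ] F) {c M : ℝ} (hc : 0 < c) (hM : ∀ v, ‖T v‖ ≤ M * ‖v‖)
    (hcv : ∀ v, c * ‖v‖ ≤ ‖T v‖) : cond T ≤ ENNReal.ofReal (M / c) := by
  have hpos : 0 < Module.finrank ℂ E := Module.finrank_pos
  have h1 : c ≤ T.singularValues (Module.finrank ℂ E - 1) := by
    obtain ⟨v, hv, h⟩ := norm_sq_adjoint_comp_self_eigenvector T (Nat.sub_one_lt hpos.ne')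
    exact le_of_mul_le_mul_right (h ▸ hcv v) (norm_pos_iff.mpr hv)
  have h2 : T.singularValues 0 ≤ M := by
    obtain ⟨v, hv, h⟩ := norm_sq_adjoint_comp_self_eigenvector T hpos
    exact le_of_mul_le_mul_right (h ▸ hM v) (norm_pos_iff.mpr hv)
  rw [cond, if_neg (hc.trans_le h1).ne']
  refine ENNReal.ofReal_le_ofReal (div_le_div₀ ?_ h2 hc h1)
  exact (T.singularValues_nonneg 0).trans h2

/-! ### Orthogonality of the columns of `A` and `B` -/

/-- A geometric sum whose ratio is an `N`-th root of unity, different from `1` because `0 < |k| <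
N`. -/
theorem sum_exp_angle_eq_zero {N : ℕ} {k : ℤ} (hk : k ≠ 0) (hkN : k.natAbs < N) :
    ∑ s : Fin N, Complex.exp (Complex.I * ((k : ℝ) * angle N s : ℝ)) = 0 := by
  have hN : (N : ℂ) ≠ 0 := by
    have : N ≠ 0 := by omega
    exact_mod_cast this
  set ζ := Complex.exp (2 * Real.pi * Complex.I * ((k : ℂ) / N)) with hζ
  -- The additional factor `ζ` reflects that angles are numbered from `1`.
  have hterm : ∀ s : Fin N, Complex.exp (Complex.I * ((k : ℝ) * angle N s : ℝ))
      = ζ * ζ ^ (s : ℕ) := by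
    intro s
    rw [← pow_succ', hζ, ← Complex.exp_nat_mul, angle]
    congr 1
    push_cast
    field_simp
  have h1 : ζ ^ N = 1 := by
    rw [hζ, ← Complex.exp_nat_mul, Complex.exp_eq_one_iff]
    exact ⟨k, by field_simp⟩
  have h2 : ζ ≠ 1 := by
    rw [hζ, Ne, Complex.exp_eq_one_iff]
    rintro ⟨n, hn⟩
    have hp : (2 * Real.pi * Complex.I : ℂ) ≠ 0 := Complex.two_pi_I_ne_zero
    rw [mul_comm (n : ℂ)] at hn
    have h3 := mul_left_cancel₀ hp hn
    rw [div_eq_iff hN] at h3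
    have h4 : k = n * N := by exact_mod_cast h3
    have h5 : k.natAbs = n.natAbs * N := by rw [h4, Int.natAbs_mul, Int.natAbs_natCast]
    have h6 : n.natAbs ≠ 0 := by
      intro h; rw [h, zero_mul] at h5; exact hk (Int.natAbs_eq_zero.mp h5)
    have := Nat.le_mul_of_pos_left N (Nat.pos_of_ne_zero h6)
    omega
  simp_rw [hterm]
  rw [← Finset.mul_sum, Fin.sum_univ_eq_sum_range (fun s => ζ ^ s), geom_sum_eq h2, h1]
  simp

theorem natAbs_order_sub_lt {K N : ℕ} (hN : 2 * K + 1 ≤ N) (m m' : Order K) :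
    ((m : ℤ) - m').natAbs < N := by
  have h1 := Finset.mem_Icc.mp m.2
  have h2 := Finset.mem_Icc.mp m'.2
  omega

theorem conj_exp_I_mul (r : ℝ) :
    conj (Complex.exp (Complex.I * (r : ℂ))) = Complex.exp (-(Complex.I * (r : ℂ))) := by
  rw [← Complex.exp_conj]; simp

/-- The plane-wave phase depends only on `s` and has modulus one, so it cancels. -/
theorem sourceMatrix_conjTranspose_mul_self (k₀ : ℝ) (z₀ : EuclideanSpace ℝ (Fin 2)) {Ns K : ℕ}
    (h : 2 * K + 1 ≤ Ns) :
    (sourceMatrix k₀ z₀ Ns K)ᴴ * sourceMatrix k₀ z₀ Ns K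
      = Matrix.diagonal fun _ => ((Ns : ℝ) : ℂ) := by
  ext m m'
  have hterm : ∀ s, conj (sourceMatrix k₀ z₀ Ns K s m) * sourceMatrix k₀ z₀ Ns K s m'
      = Complex.exp (Complex.I * (((m' : ℤ) - (m : ℤ) : ℤ) * (Real.pi / 2) : ℝ)) *
        Complex.exp (Complex.I * ((((m : ℤ) - (m' : ℤ) : ℤ) : ℝ) * angle Ns s : ℝ)) := by
    intro s
    simp only [sourceMatrix, Matrix.of_apply]
    rw [map_mul, conj_exp_I_mul, conj_exp_I_mul, ← Complex.exp_add, ← Complex.exp_add,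
      ← Complex.exp_add, ← Complex.exp_add]
    congr 1
    push_cast
    ring
  simp only [Matrix.mul_apply, Matrix.conjTranspose_apply, Matrix.diagonal_apply,
    ← starRingEnd_apply, hterm]
  split_ifs with hm
  · subst hm
    simp
  · rw [← Finset.mul_sum, sum_exp_angle_eq_zero (sub_ne_zero.mpr fun h => hm (Subtype.ext h))
      (natAbs_order_sub_lt h m m'), mul_zero]

theorem receiverMatrix_conjTranspose_mul_self (k₀ R : ℝ) {Nr K : ℕ} (h : 2 * K + 1 ≤ Nr) :
    (receiverMatrix k₀ R Nr K)ᴴ * receiverMatrix k₀ R Nr K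
      = Matrix.diagonal fun n : Order K => ((Nr / 16 * ‖hankel1 (n : ℤ) (k₀ * R)‖ ^ 2 : ℝ) : ℂ) := by
  ext n n'
  have hterm : ∀ r, conj (receiverMatrix k₀ R Nr K r n) * receiverMatrix k₀ R Nr K r n'
      = 1 / 16 * (hankel1 (n : ℤ) (k₀ * R) * conj (hankel1 (n' : ℤ) (k₀ * R))) *
        Complex.exp (Complex.I * ((((n : ℤ) - (n' : ℤ) : ℤ) : ℝ) * angle Nr r : ℝ)) := by
    intro r
    have he : Complex.exp (Complex.I * ((((n : ℤ) - (n' : ℤ) : ℤ) : ℝ) * angle Nr r : ℝ))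
        = Complex.exp (Complex.I * (((n : ℤ) : ℝ) * angle Nr r : ℝ)) *
          Complex.exp (-(Complex.I * (((n' : ℤ) : ℝ) * angle Nr r : ℝ))) := by
      rw [← Complex.exp_add]
      congr 1
      push_cast
      ring
    rw [he]
    simp only [receiverMatrix, Matrix.of_apply, map_mul, map_div₀, Complex.conj_I,
      Complex.conj_conj, ← conj_exp_I_mul, map_ofNat]
    linear_combination (-(1 / 16) * hankel1 (n : ℤ) (k₀ * R) * conj (hankel1 (n' : ℤ) (k₀ * R))
      * Complex.exp (Complex.I * (((n : ℤ) : ℝ) * angle Nr r : ℝ))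
      * conj (Complex.exp (Complex.I * (((n' : ℤ) : ℝ) * angle Nr r : ℝ)))) * Complex.I_sq
  simp only [Matrix.mul_apply, Matrix.conjTranspose_apply, Matrix.diagonal_apply,
    ← starRingEnd_apply, hterm]
  split_ifs with hn
  · subst hn
    rw [Complex.mul_conj, Complex.normSq_eq_norm_sq]
    simp
    ring
  · rw [← Finset.mul_sum, sum_exp_angle_eq_zero (sub_ne_zero.mpr fun h => hn (Subtype.ext h))
      (natAbs_order_sub_lt h n n'), mul_zero]

/-! ### Frobenius norm of `A X Bᴴ` -/

section Orthogonal

variable {ι κ μ ν : Type*} [Fintype ι] [Fintype κ] [Fintype μ] [Fintype ν] [DecidableEq κ]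
  [DecidableEq ν]

theorem sum_norm_sq_mulVec {A : Matrix ι κ ℂ} {d : κ → ℝ}
    (hA : Aᴴ * A = Matrix.diagonal fun m => (d m : ℂ)) (v : κ → ℂ) :
    ∑ s, ‖(A *ᵥ v) s‖ ^ 2 = ∑ m, d m * ‖v m‖ ^ 2 := by
  have h1 (w : ι → ℂ) : star w ⬝ᵥ w = ((∑ s, ‖w s‖ ^ 2 : ℝ) : ℂ) := by
    simp only [dotProduct, Pi.star_apply]
    push_cast
    exact Finset.sum_congr rfl fun s _ => Complex.conj_mul' _
  have h2 : star (A *ᵥ v) ⬝ᵥ (A *ᵥ v) = ((∑ m, d m * ‖v m‖ ^ 2 : ℝ) : ℂ) := by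
    rw [Matrix.star_mulVec, Matrix.dotProduct_mulVec, Matrix.vecMul_vecMul, hA,
      ← Matrix.dotProduct_mulVec, dotProduct]
    push_cast
    refine Finset.sum_congr rfl fun m _ => ?_
    rw [Matrix.mulVec_diagonal, Pi.star_apply, ← Complex.conj_mul', starRingEnd_apply]
    ring
  rw [h1] at h2
  exact_mod_cast h2

theorem sum_norm_sq_mul_mul_conjTranspose {A : Matrix ι κ ℂ} {B : Matrix μ ν ℂ} {d : κ → ℝ}
    {e : ν → ℝ} (hA : Aᴴ * A = Matrix.diagonal fun m => (d m : ℂ))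
    (hB : Bᴴ * B = Matrix.diagonal fun n => (e n : ℂ)) (X : Matrix κ ν ℂ) :
    ∑ p : ι × μ, ‖(A * X * Bᴴ) p.1 p.2‖ ^ 2 = ∑ q : κ × ν, d q.1 * e q.2 * ‖X q.1 q.2‖ ^ 2 := by
  -- Each row of `A X Bᴴ` is the conjugate of `B` applied to the conjugate row of `A X`; thus `B`
  -- acts row by row, then `A` column by column.
  have h1 : ∀ s r, ‖(A * X * Bᴴ) s r‖ = ‖(B *ᵥ star ((A * X) s)) r‖ := by
    intro s r
    rw [← norm_star (B.mulVec _ _), Matrix.mul_apply, Matrix.mulVec, dotProduct, star_sum]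
    congr 1
    refine Finset.sum_congr rfl fun n _ => ?_
    simp [mul_comm]
  have h2 : ∀ s n, (A * X) s n = (A *ᵥ X.col n) s := fun s n => rfl
  rw [Fintype.sum_prod_type, Fintype.sum_prod_type]
  simp_rw [h1, sum_norm_sq_mulVec hB, Pi.star_apply, norm_star, h2]
  rw [Finset.sum_comm]
  simp_rw [← Finset.mul_sum, sum_norm_sq_mulVec hA, Finset.mul_sum]
  rw [Finset.sum_comm]
  refine Finset.sum_congr rfl fun m _ => Finset.sum_congr rfl fun n _ => ?_
  simp only [Matrix.col_apply]
  ring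

end Orthogonal

theorem norm_sq_opL (k₀ R : ℝ) (z₀ : EuclideanSpace ℝ (Fin 2)) {Ns Nr K : ℕ}
    (hs : 2 * K + 1 ≤ Ns) (hr : 2 * K + 1 ≤ Nr) (X : FrobeniusSpace (Order K) (Order K)) :
    ‖opL k₀ R z₀ Ns Nr K X‖ ^ 2
      = ∑ q, Ns * (Nr / 16 * ‖hankel1 (q.2 : ℤ) (k₀ * R)‖ ^ 2) * ‖X q‖ ^ 2 := by
  rw [EuclideanSpace.norm_sq_eq]
  exact sum_norm_sq_mul_mul_conjTranspose (sourceMatrix_conjTranspose_mul_self k₀ z₀ hs)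
    (receiverMatrix_conjTranspose_mul_self k₀ R hr) (toMatrix X)

theorem norm_opL_le (k₀ R : ℝ) (z₀ : EuclideanSpace ℝ (Fin 2)) {Ns Nr K : ℕ}
    (hs : 2 * K + 1 ≤ Ns) (hr : 2 * K + 1 ≤ Nr) {M : ℝ} (hM : 0 ≤ M)
    (h : ∀ n : Order K, ‖hankel1 (n : ℤ) (k₀ * R)‖ ≤ M) (X : FrobeniusSpace (Order K) (Order K)) :
    ‖opL k₀ R z₀ Ns Nr K X‖ ≤ Real.sqrt (Ns * (Nr / 16)) * M * ‖X‖ := by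
  refine le_of_sq_le_sq ?_ (by positivity)
  rw [norm_sq_opL k₀ R z₀ hs hr, mul_pow, mul_pow, Real.sq_sqrt (by positivity),
    EuclideanSpace.norm_sq_eq, Finset.mul_sum]
  refine Finset.sum_le_sum fun q _ => ?_
  have := h q.2
  rw [mul_assoc (Ns : ℝ) (Nr / 16 : ℝ)]
  gcongr

theorem le_norm_opL (k₀ R : ℝ) (z₀ : EuclideanSpace ℝ (Fin 2)) {Ns Nr K : ℕ}
    (hs : 2 * K + 1 ≤ Ns) (hr : 2 * K + 1 ≤ Nr) {c : ℝ} (hc : 0 ≤ c)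
    (h : ∀ n : Order K, c ≤ ‖hankel1 (n : ℤ) (k₀ * R)‖) (X : FrobeniusSpace (Order K) (Order K)) :
    Real.sqrt (Ns * (Nr / 16)) * c * ‖X‖ ≤ ‖opL k₀ R z₀ Ns Nr K X‖ := by
  refine le_of_sq_le_sq ?_ (norm_nonneg _)
  rw [norm_sq_opL k₀ R z₀ hs hr, mul_pow, mul_pow, Real.sq_sqrt (by positivity),
    EuclideanSpace.norm_sq_eq, Finset.mul_sum]
  refine Finset.sum_le_sum fun q _ => ?_
  have := h q.2
  rw [mul_assoc (Ns : ℝ) (Nr / 16 : ℝ)]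
  gcongr

end CircularAcquisition

end

/-! ### Condition number estimate -/

theorem mainTheorem5 (t : ℝ) (ht : 0 < t) :
    ∃ C : ℝ, 0 < C ∧ ∀ᶠ K : ℕ in atTop,
      ∀ k₀ R : ℝ, 0 < k₀ → 0 < R → k₀ * R = t →
      ∀ z₀ : EuclideanSpace ℝ (Fin 2),
      ∀ Ns Nr : ℕ, 2 * K + 1 ≤ Ns → 2 * K + 1 ≤ Nr →
        CircularAcquisition.cond (CircularAcquisition.opL k₀ R z₀ Ns Nr K) ≤
          ENNReal.ofReal (C * (CircularAcquisition.constCR k₀ R * (K : ℝ)) ^ K) := by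
  obtain ⟨c, hc, hlow⟩ := CircularAcquisition.exists_le_norm_hankel1 ht
  obtain ⟨M, hM, hup⟩ := CircularAcquisition.exists_norm_hankel1_le ht
  refine ⟨M / c, by positivity, ?_⟩
  filter_upwards [eventually_ge_atTop 1] with K hK
  intro k₀ R _ _ hkR z₀ Ns Nr hs hr
  have : Nonempty (CircularAcquisition.Order K) := ⟨⟨0, by simp⟩⟩
  have hNs : (0 : ℝ) < Ns := by exact_mod_cast (by omega : 0 < Ns)
  have hNr : (0 : ℝ) < Nr := by exact_mod_cast (by omega : 0 < Nr)
  have hq : 0 < Real.sqrt (Ns * (Nr / 16 : ℝ)) := by positivity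
  refine (CircularAcquisition.cond_le _ (mul_pos hq hc)
    (CircularAcquisition.norm_opL_le k₀ R z₀ hs hr
      (M := M * (2 / (Real.exp 1 * t) * K) ^ K) (by positivity) fun n => ?_)
    (CircularAcquisition.le_norm_opL k₀ R z₀ hs hr hc.le fun n => ?_)).trans (le_of_eq ?_)
  · rw [hkR]
    have hn := Finset.mem_Icc.mp n.2
    exact hup K hK n (by omega)
  · rw [hkR]
    exact hlow n
  -- The common factor `√(N_s N_r / 16)` cancels in the quotient, so the bound is uniform in `N_s`
  -- and `N_r`.
  · rw [CircularAcquisition.constCR, mul_assoc (Real.exp 1), hkR, mul_div_mul_left _ _ hq.ne']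
    ring_nf
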